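/- Let $\Gamma$ be a countable group, $\Gamma_0\subset\Gamma$ a subgroup, and let $\Gamma_0$ act by measure preserving Borel transformations on a standard probability space $(X,\mu)$, where $\mu$ is not a point mass. A measure preserving action of a countable group $\Lambda$ on a standard probability space $(Z,\zeta)$ is called *rigid* (or is said to have *property (T) relative to the space*) if every sequence $(\nu_n)$ of Borel probability measures on $Z\times Z$ such that 1. both marginals of every $\nu_n$ are equal to $\zeta$, 2. $\int_{Z\times Z}\varphi(x)\psi(y)\,d\nu_n(x,y)\to\int_Z\varphi(x)\psi(x)\,d\zeta(x)$ for all bounded Borel functions $\varphi,\psi:Z\to\mathbb{C}$, 3. $\|(\lambda\times\lambda)_*\nu_n-\nu_n\|\to 0$ in total variation for every $\lambda\in\Lambda$, satisfies $\nu_n(\Delta_Z)\to 1$, where $\Delta_Z=\{(z,z):z\in Z\}$. Let $D\subset\Gamma$ be a set of representatives of the left cosets $g\Gamma_0$. For $\gamma\in\Gamma$ and $d\in D$, let $\gamma.d\in D$ and $\sigma(\gamma,d)\in\Gamma_0$ be determined by $\gamma d=(\gamma.d)\,\sigma(\gamma,d)$. The co-induced action of $\Gamma$ on $(Y,\eta)=(\prod_D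 X,\bigotimes_D\mu)$ is $$\gamma\,(x_d)_{d\in D}=\bigl(\sigma(\gamma^{-1},d)^{-1}x_{\gamma^{-1}.d}\bigr)_{d\in D}.$$ Suppose that the action of $\Gamma_0$ on $(X,\mu)$ is rigid. Then the co-induced action of $\Gamma$ on $(Y,\eta)$ is rigid if and only if $[\Gamma:\Gamma_0]<\infty$. -/

import Mathlib

open MeasureTheory Filter Topology

/-- The total variation norm `‖ν - ν'‖` of the difference of two finite measures, i.e. the mass of
the total variation measure of the signed measure `ν - ν'`. -/
noncomputable def tvDist {Z : Type*} [MeasurableSpace Z] (ν ν' : Measure Z)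
    [IsFiniteMeasure ν] [IsFiniteMeasure ν'] : ENNReal :=
  (ν.toSignedMeasure - ν'.toSignedMeasure).totalVariation Set.univ

/-- Rigidity (property (T) relative to the space) of a measure preserving action of a countable
group `Γ` on a standard probability space `(X, μ)`: every sequence of probability measures `ν n`
on `X × X` that

* has both marginals equal to `μ`,
* satisfies `∫ φ(x) ψ(y) dν n (x, y) → ∫ φ(x) ψ(x) dμ(x)` for all bounded Borel functions `φ`, `ψ`,
* is asymptotically invariant in total variation under the diagonal action of each `γ : Γ`,

satisfies `ν n (diagonal) → 1`. -/
def IsRigidAction (Γ : Type*) {X : Type*} [Group Γ] [MulAction Γ X] [MeasurableSpace X]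
    (μ : Measure X) : Prop :=
  ∀ ν : ℕ → ProbabilityMeasure (X × X),
    (∀ n, (ν n : Measure (X × X)).map Prod.fst = μ) →
    (∀ n, (ν n : Measure (X × X)).map Prod.snd = μ) →
    (∀ φ ψ : X → ℂ, Measurable φ → Measurable ψ →
      (∃ C : ℝ, ∀ x, ‖φ x‖ ≤ C) → (∃ C : ℝ, ∀ x, ‖ψ x‖ ≤ C) →
      Tendsto (fun n => ∫ p, φ p.1 * ψ p.2 ∂(ν n : Measure (X × X))) atTop
        (𝓝 (∫ x, φ x * ψ x ∂μ))) →
    (∀ γ : Γ, Tendsto (fun n =>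
      tvDist ((ν n : Measure (X × X)).map (fun p => (γ • p.1, γ • p.2))) (ν n : Measure (X × X)))
        atTop (𝓝 0)) →
    Tendsto (fun n => (ν n : Measure (X × X)) (Set.diagonal X)) atTop (𝓝 1)

section Coinduction

variable {Γ : Type*} [Group Γ] {Γ₀ : Subgroup Γ} {D : Set Γ}

/-- The action of `Γ` on a fundamental domain `D` for the right action of `Γ₀` on `Γ` (a set of
representatives of the left cosets `g Γ₀`): `γ . d` is the element of `D` in the coset `γ d Γ₀`. -/
noncomputable def domAct (hD : Subgroup.IsComplement D (Γ₀ : Set Γ)) (γ : Γ) (d : D) : D :=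
  (hD.equiv (γ * d)).1

/-- The cocycle `σ : Γ × D → Γ₀`, determined by `γ d = (γ . d) σ(γ, d)`. -/
noncomputable def domCocycle (hD : Subgroup.IsComplement D (Γ₀ : Set Γ)) (γ : Γ) (d : D) : Γ₀ :=
  (hD.equiv (γ * d)).2

theorem domAct_mul_domCocycle (hD : Subgroup.IsComplement D (Γ₀ : Set Γ)) (γ : Γ) (d : D) :
    (domAct hD γ d : Γ) * (domCocycle hD γ d : Γ) = γ * d :=
  hD.equiv_fst_mul_equiv_snd (γ * d)

theorem dom_unique (hD : Subgroup.IsComplement D (Γ₀ : Set Γ)) {γ : Γ} {d d' : D} {s : Γ₀}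
    (h : (d' : Γ) * (s : Γ) = γ * d) : domAct hD γ d = d' ∧ domCocycle hD γ d = s := by
  have key : hD.equiv (γ * d) = (d', s) := by
    rw [← h]
    exact hD.equiv.apply_symm_apply (d', s)
  exact ⟨congrArg Prod.fst key, congrArg Prod.snd key⟩

/-- The co-induced action of `Γ` on `∏_D X`, for an action of `Γ₀` on `X`:
`(γ x)_d = σ(γ⁻¹, d)⁻¹ x_{γ⁻¹ . d}`. -/
@[reducible]
noncomputable def coinducedAction (hD : Subgroup.IsComplement D (Γ₀ : Set Γ))
    (X : Type*) [MulAction Γ₀ X] : MulAction Γ (D → X) where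
  smul γ x := fun d => (domCocycle hD γ⁻¹ d)⁻¹ • x (domAct hD γ⁻¹ d)
  one_smul x := by
    funext d
    obtain ⟨h1, h2⟩ := dom_unique hD (γ := (1 : Γ)⁻¹) (d := d) (d' := d) (s := 1) (by simp)
    change (domCocycle hD (1 : Γ)⁻¹ d)⁻¹ • x (domAct hD (1 : Γ)⁻¹ d) = x d
    rw [h1, h2, inv_one, one_smul]
  mul_smul a b x := by
    funext d
    change (domCocycle hD (a * b)⁻¹ d)⁻¹ • x (domAct hD (a * b)⁻¹ d) =
      (domCocycle hD a⁻¹ d)⁻¹ • (domCocycle hD b⁻¹ (domAct hD a⁻¹ d))⁻¹ •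
        x (domAct hD b⁻¹ (domAct hD a⁻¹ d))
    obtain ⟨h1, h2⟩ := dom_unique hD (γ := (a * b)⁻¹) (d := d)
      (d' := domAct hD b⁻¹ (domAct hD a⁻¹ d))
      (s := domCocycle hD b⁻¹ (domAct hD a⁻¹ d) * domCocycle hD a⁻¹ d) (by
        rw [Subgroup.coe_mul, ← mul_assoc, domAct_mul_domCocycle, mul_assoc,
          domAct_mul_domCocycle, mul_inv_rev, mul_assoc])
    rw [h1, h2, mul_inv_rev, mul_smul]

end Coinduction

/-! If `D` is finite, project the couplings to a coordinate `d`. The conjugate `d s d⁻¹` acts on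
that coordinate as `s`, so the projections inherit all hypotheses of rigidity for `Γ₀`, and the
coordinates agree with probability tending to 1. A union bound over `D` concludes
(`isRigidAction_coinduced_of_finite`).

If `D` is infinite, couple each coordinate independently by `mixCoupling μ t`. The product is
exactly `Γ`-invariant, because each `γ` permutes coordinates and applies measure preserving maps in
them (`piCoupling_map_prodMap`). As `t → 0` cylinders decouple less and less, which passes to all
Borel sets and then to bounded functions. Yet for each `t > 0` the diagonal is null: it lies in
infinitely many independent events of equal probability less than 1 (`piCoupling_diagonal_eq_zero`).
-/

theorem tvDist_congr {Z : Type*} [MeasurableSpace Z] {ν ν' ρ ρ' : Measure Z}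
    [IsFiniteMeasure ν] [IsFiniteMeasure ν'] [IsFiniteMeasure ρ] [IsFiniteMeasure ρ']
    (h : ν = ρ) (h' : ν' = ρ') : tvDist ν ν' = tvDist ρ ρ' := by
  subst h h'
  rfl

theorem tvDist_self {Z : Type*} [MeasurableSpace Z] (ν : Measure Z) [IsFiniteMeasure ν] :
    tvDist ν ν = 0 := by
  simp [tvDist, SignedMeasure.totalVariation_zero]

theorem tvDist_map_le {Z W : Type*} [MeasurableSpace Z] [MeasurableSpace W]
    (ν ν' : Measure Z) [IsFiniteMeasure ν] [IsFiniteMeasure ν'] {f : Z → W} (hf : Measurable f) :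
    tvDist (ν.map f) (ν'.map f) ≤ tvDist ν ν' := by
  unfold tvDist
  rw [SignedMeasure.totalVariation_eq_variation ((ν.map f).toSignedMeasure - _)]
  -- The variation is the least measure dominating the absolute values, so a setwise bound suffices.
  have h : ((ν.map f).toSignedMeasure - (ν'.map f).toSignedMeasure).variation ≤
      ((ν.toSignedMeasure - ν'.toSignedMeasure).totalVariation).map f := by
    refine VectorMeasure.variation_le_of_forall_enorm_le fun s hs => ?_
    rw [Measure.map_apply hf hs]
    convert SignedMeasure.enorm_le_totalVariation _ (f ⁻¹' s) using 2
    rw [Measure.toSignedMeasure_sub_apply hs, Measure.toSignedMeasure_sub_apply (hf hs),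
      map_measureReal_apply hf hs, map_measureReal_apply hf hs]
  refine (h Set.univ).trans ?_
  rw [Measure.map_apply hf .univ, Set.preimage_univ]

/-! ### Couplings concentrating near the diagonal: from sets to functions. -/

section Concentration

variable {Z : Type*} [MeasurableSpace Z] {η : Measure Z} {ν : ℕ → Measure (Z × Z)}

/-- If `ν n` gives asymptotically no mass to `A × Aᶜ` for each measurable `A`, then
`φ(x) - φ(y)` tends to `0` in `L¹(ν n)` for each integrable `φ`. -/
theorem tendsto_lintegral_enorm_fst_sub_snd
    (h₁ : ∀ n, (ν n).map Prod.fst = η) (h₂ : ∀ n, (ν n).map Prod.snd = η)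
    (hν : ∀ A, MeasurableSet A → Tendsto (fun n => ν n (A ×ˢ Aᶜ)) atTop (𝓝 0))
    {φ : Z → ℂ} (hφ : Integrable φ η) :
    Tendsto (fun n => ∫⁻ p, ‖φ p.1 - φ p.2‖ₑ ∂ν n) atTop (𝓝 0) := by
  have q₁ (n) : MeasurePreserving Prod.fst (ν n) η := ⟨measurable_fst, h₁ n⟩
  have q₂ (n) : MeasurePreserving Prod.snd (ν n) η := ⟨measurable_snd, h₂ n⟩
  -- As both marginals are `η`, replacing `f` by `g` costs `2‖f - g‖₁` uniformly in `n`; this makes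
  -- the property closed in `L¹`.
  have tri : ∀ {f g : Z → ℂ}, Integrable f η → Integrable g η → ∀ n,
      ∫⁻ p, ‖f p.1 - f p.2‖ₑ ∂ν n ≤
        (∫⁻ z, ‖f z - g z‖ₑ ∂η + ∫⁻ z, ‖f z - g z‖ₑ ∂η) + ∫⁻ p, ‖g p.1 - g p.2‖ₑ ∂ν n := by
    intro f g hf hg n
    have hm : AEMeasurable (fun z => ‖f z - g z‖ₑ) η := (hf.sub hg).aestronglyMeasurable.enorm
    have e₁ : ∫⁻ z, ‖f z - g z‖ₑ ∂η = ∫⁻ p, ‖f p.1 - g p.1‖ₑ ∂ν n := by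
      rw [← h₁ n, lintegral_map' (by rwa [h₁ n]) (by fun_prop)]
    have e₂ : ∫⁻ z, ‖f z - g z‖ₑ ∂η = ∫⁻ p, ‖f p.2 - g p.2‖ₑ ∂ν n := by
      rw [← h₂ n, lintegral_map' (by rwa [h₂ n]) (by fun_prop)]
    have m₁ : AEMeasurable (fun p : Z × Z => ‖f p.1 - g p.1‖ₑ) (ν n) :=
      hm.comp_quasiMeasurePreserving (q₁ n).quasiMeasurePreserving
    have m₂ : AEMeasurable (fun p : Z × Z => ‖f p.2 - g p.2‖ₑ) (ν n) :=
      hm.comp_quasiMeasurePreserving (q₂ n).quasiMeasurePreserving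
    nth_rewrite 1 [e₁]
    rw [e₂, ← lintegral_add_left' m₁, ← lintegral_add_left' (by exact m₁.add m₂)]
    refine lintegral_mono fun p => ?_
    calc ‖f p.1 - f p.2‖ₑ = ‖(f p.1 - g p.1) - (f p.2 - g p.2) + (g p.1 - g p.2)‖ₑ := by
          congr 1; ring
      _ ≤ _ := (enorm_add_le _ _).trans (by gcongr; exact enorm_sub_le)
  refine Integrable.induction (fun φ : Z → ℂ =>
    Tendsto (fun n => ∫⁻ p, ‖φ p.1 - φ p.2‖ₑ ∂ν n) atTop (𝓝 0)) ?_ ?_ ?_ ?_ hφ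
  · intro c s hs _
    have hle : ∀ n, ∫⁻ p, ‖s.indicator (fun _ => c) p.1 - s.indicator (fun _ => c) p.2‖ₑ ∂ν n ≤
        ‖c‖ₑ * (ν n (s ×ˢ sᶜ) + ν n (sᶜ ×ˢ sᶜᶜ)) := by
      intro n
      rw [mul_add, ← lintegral_indicator_const (hs.prod hs.compl),
        ← lintegral_indicator_const (hs.compl.prod hs.compl.compl), ← lintegral_add_left
          (measurable_const.indicator (hs.prod hs.compl))]
      refine lintegral_mono fun p => ?_
      by_cases a : p.1 ∈ s <;> by_cases b : p.2 ∈ s <;> simp [Set.indicator, a, b]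
    refine tendsto_of_tendsto_of_tendsto_of_le_of_le tendsto_const_nhds ?_ (fun _ => zero_le)
      hle
    simpa using ENNReal.Tendsto.const_mul ((hν s hs).add (hν sᶜ hs.compl))
      (.inr enorm_ne_top : _ ∨ ‖c‖ₑ ≠ ⊤)
  · intro f g _ hf hg hPf hPg
    refine tendsto_of_tendsto_of_tendsto_of_le_of_le tendsto_const_nhds
      (by simpa using hPf.add hPg) (fun _ => zero_le) fun n => ?_
    have hm : AEMeasurable (fun p : Z × Z => ‖f p.1 - f p.2‖ₑ) (ν n) :=
      ((hf.aestronglyMeasurable.comp_measurePreserving (q₁ n)).sub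
        (hf.aestronglyMeasurable.comp_measurePreserving (q₂ n))).enorm
    rw [← lintegral_add_left' hm]
    refine lintegral_mono fun p => ?_
    calc ‖(f + g) p.1 - (f + g) p.2‖ₑ = ‖(f p.1 - f p.2) + (g p.1 - g p.2)‖ₑ := by
          simp only [Pi.add_apply]; congr 1; ring
      _ ≤ _ := enorm_add_le _ _
  · refine isClosed_of_closure_subset fun f hf => ?_
    rw [Set.mem_ofPred_eq, ENNReal.tendsto_nhds_zero]
    intro ε hε
    obtain ⟨g, hg, hfg⟩ := EMetric.mem_closure_iff.1 hf (ε / 4)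
      (ENNReal.div_pos hε.ne' (by simp))
    rw [Lp.edist_def, eLpNorm_one_eq_lintegral_enorm] at hfg
    have hg' := ENNReal.tendsto_nhds_zero.1 hg (ε / 2) (ENNReal.div_pos hε.ne' (by simp))
    filter_upwards [hg'] with n hn
    refine (tri (L1.integrable_coeFn f) (L1.integrable_coeFn g) n).trans ?_
    refine (add_le_add (add_le_add hfg.le hfg.le) hn).trans ?_
    have : ε / 4 + ε / 4 = ε / 2 := by
      rw [← two_mul, show (4 : ENNReal) = 2 * 2 by norm_num, ENNReal.div_eq_inv_mul,
        ENNReal.mul_inv (by simp) (by simp), ← mul_assoc, ← mul_assoc,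
        ENNReal.mul_inv_cancel (by simp) (by simp), one_mul, ENNReal.div_eq_inv_mul]
    rw [this, ENNReal.add_halves]
  · intro f g hfg hf hPf
    refine hPf.congr fun n => lintegral_congr_ae ?_
    filter_upwards [(q₁ n).quasiMeasurePreserving.ae hfg, (q₂ n).quasiMeasurePreserving.ae hfg]
      with p hp₁ hp₂
    rw [hp₁, hp₂]

theorem tendsto_integral_mul_of_tendsto_prod_compl [IsProbabilityMeasure η]
    (h₁ : ∀ n, (ν n).map Prod.fst = η) (h₂ : ∀ n, (ν n).map Prod.snd = η)
    (hν : ∀ A, MeasurableSet A → Tendsto (fun n => ν n (A ×ˢ Aᶜ)) atTop (𝓝 0))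
    {φ ψ : Z → ℂ} (hφ : Measurable φ) (hψ : Measurable ψ)
    (bφ : ∃ C : ℝ, ∀ x, ‖φ x‖ ≤ C) (bψ : ∃ C : ℝ, ∀ x, ‖ψ x‖ ≤ C) :
    Tendsto (fun n => ∫ p, φ p.1 * ψ p.2 ∂ν n) atTop (𝓝 (∫ x, φ x * ψ x ∂η)) := by
  obtain ⟨C, hC⟩ := bφ
  obtain ⟨K, hK⟩ := bψ
  have hprob : ∀ n, IsProbabilityMeasure (ν n) := fun n => by
    have : IsProbabilityMeasure ((ν n).map Prod.fst) := by rw [h₁]; infer_instance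
    exact Measure.isProbabilityMeasure_of_map (f := Prod.fst)
  have hint : Integrable φ η := .of_bound hφ.aestronglyMeasurable C (.of_forall hC)
  have key := tendsto_lintegral_enorm_fst_sub_snd h₁ h₂ hν hint
  have bd : ∀ (f : Z × Z → Z), Measurable f → ∀ n,
      Integrable (fun p : Z × Z => φ (f p) * ψ p.2) (ν n) := fun f hf n =>
    .of_bound (by fun_prop) (C * K) (.of_forall fun p => by
      rw [norm_mul]
      exact mul_le_mul (hC _) (hK _) (norm_nonneg _) ((norm_nonneg _).trans (hC p.1)))
  -- Written over `ν n`, the limit differs from the integral only by `(φ p.1 - φ p.2) * ψ p.2`, with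
  -- `ψ` bounded.
  have e : ∀ n, ∫ x, φ x * ψ x ∂η = ∫ p, φ p.2 * ψ p.2 ∂ν n := fun n => by
    rw [← h₂ n, integral_map (by fun_prop) (by fun_prop)]
  rw [tendsto_iff_edist_tendsto_0]
  have lim := ENNReal.Tendsto.mul_const key
    (.inr ENNReal.ofReal_ne_top : _ ∨ ENNReal.ofReal K ≠ ⊤)
  rw [zero_mul] at lim
  refine tendsto_of_tendsto_of_tendsto_of_le_of_le tendsto_const_nhds lim
    (fun _ => zero_le) fun n => ?_
  dsimp only
  rw [e n, edist_eq_enorm_sub, ← integral_sub (bd _ measurable_fst n) (bd _ measurable_snd n)]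
  refine (enorm_integral_le_lintegral_enorm _).trans ?_
  rw [← lintegral_mul_const _ (by fun_prop)]
  refine lintegral_mono fun p => ?_
  rw [← sub_mul, enorm_mul]
  gcongr
  rw [← ofReal_norm]
  exact ENNReal.ofReal_le_ofReal (hK _)

/-- The sets `A` such that `A × Aᶜ` and `Aᶜ × A` are asymptotically null form a `σ`-algebra. -/
theorem tendsto_prod_compl_of_generateFrom [IsFiniteMeasure η] {C : Set (Set Z)}
    (hgen : ‹MeasurableSpace Z› = MeasurableSpace.generateFrom C)
    (h₁ : ∀ n, (ν n).map Prod.fst = η) (h₂ : ∀ n, (ν n).map Prod.snd = η)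
    (hC : ∀ A ∈ C, Tendsto (fun n => ν n (A ×ˢ Aᶜ)) atTop (𝓝 0) ∧
      Tendsto (fun n => ν n (Aᶜ ×ˢ A)) atTop (𝓝 0))
    {A : Set Z} (hA : MeasurableSet A) :
    Tendsto (fun n => ν n (A ×ˢ Aᶜ)) atTop (𝓝 0) := by
  suffices H : ∀ A (_ : MeasurableSet[MeasurableSpace.generateFrom C] A),
      Tendsto (fun n => ν n (A ×ˢ Aᶜ)) atTop (𝓝 0) ∧
      Tendsto (fun n => ν n (Aᶜ ×ˢ A)) atTop (𝓝 0) from (H A (hgen ▸ hA)).1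
  refine MeasurableSpace.generateFrom_induction C _ (fun t ht _ => hC t ht) (by simp)
    (fun t _ ht => by simpa using ht.symm) fun s hs ih => ?_
  rw [← hgen] at hs
  set U := ⋃ i, s i
  have hU : MeasurableSet U := .iUnion hs
  have hs' : ∀ N, MeasurableSet (U \ Set.accumulate s N) := fun N =>
    hU.diff (.biUnion (Set.to_countable _) fun i _ => hs i)
  -- The marginals bound the tail of the union by this quantity for all `n` at once; only finitely
  -- many `s i` remain.
  have htail : Tendsto (fun N => η (U \ Set.accumulate s N)) atTop (𝓝 0) := by
    have hanti : Antitone fun N => U \ Set.accumulate s N := fun _ _ h =>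
      Set.sdiff_subset_sdiff_right (Set.monotone_accumulate h)
    have := tendsto_measure_iInter_atTop (μ := η) (s := fun N => U \ Set.accumulate s N)
      (fun N => (hs' N).nullMeasurableSet) hanti ⟨0, measure_ne_top _ _⟩
    rwa [← Set.sdiff_iUnion, Set.iUnion_accumulate, Set.sdiff_self, measure_empty] at this
  have cover : ∀ N, U ⊆ (U \ Set.accumulate s N) ∪ ⋃ i ∈ Finset.range (N + 1), s i := by
    intro N x hx
    by_cases h : x ∈ Set.accumulate s N
    · obtain ⟨i, hi, hxi⟩ := Set.mem_accumulate.1 h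
      exact .inr (Set.mem_biUnion (Finset.mem_range.2 (by omega)) hxi)
    · exact .inl ⟨hx, h⟩
  have gen : ∀ (T : Set Z → ℕ → ENNReal), (∀ i, Tendsto (T (s i)) atTop (𝓝 0)) →
      (∀ N n, T U n ≤ η (U \ Set.accumulate s N) + ∑ i ∈ Finset.range (N + 1), T (s i) n) →
      Tendsto (T U) atTop (𝓝 0) := by
    intro T hT hle
    rw [ENNReal.tendsto_nhds_zero]
    intro ε hε
    have hε' : 0 < ε / 2 := ENNReal.div_pos hε.ne' (by simp)
    obtain ⟨N, hN⟩ := (ENNReal.tendsto_nhds_zero.1 htail _ hε').exists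
    have hsum : Tendsto (fun n => ∑ i ∈ Finset.range (N + 1), T (s i) n) atTop (𝓝 0) := by
      simpa using tendsto_finsetSum (Finset.range (N + 1)) fun i _ => hT i
    filter_upwards [ENNReal.tendsto_nhds_zero.1 hsum _ hε'] with n hn
    exact (hle N n).trans ((add_le_add hN hn).trans_eq (ENNReal.add_halves ε))
  constructor
  · refine gen (fun A n => ν n (A ×ˢ Aᶜ)) (fun i => (ih i).1) fun N n => ?_
    rw [← h₁ n, Measure.map_apply measurable_fst (hs' N)]
    refine (measure_mono ?_).trans ((measure_union_le _ _).trans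
      (add_le_add_right (measure_biUnion_finset_le (Finset.range (N + 1))
        fun i => s i ×ˢ (s i)ᶜ) _))
    rintro ⟨x, y⟩ ⟨hx, hy⟩
    rcases cover N hx with h | h
    · exact .inl h
    · obtain ⟨i, hi, hxi⟩ := Set.mem_iUnion₂.1 h
      exact .inr (Set.mem_biUnion hi ⟨hxi, fun h => hy (Set.mem_iUnion_of_mem i h)⟩)
  · refine gen (fun A n => ν n (Aᶜ ×ˢ A)) (fun i => (ih i).2) fun N n => ?_
    rw [← h₂ n, Measure.map_apply measurable_snd (hs' N)]
    refine (measure_mono ?_).trans ((measure_union_le _ _).trans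
      (add_le_add_right (measure_biUnion_finset_le (Finset.range (N + 1))
        fun i => (s i)ᶜ ×ˢ s i) _))
    rintro ⟨y, x⟩ ⟨hy, hx⟩
    rcases cover N hx with h | h
    · exact .inl h
    · obtain ⟨i, hi, hxi⟩ := Set.mem_iUnion₂.1 h
      exact .inr (Set.mem_biUnion hi ⟨fun h => hy (Set.mem_iUnion_of_mem i h), hxi⟩)

end Concentration

/-! ### Mixtures of the diagonal and independent couplings. -/

section Coupling

variable {X : Type*} [MeasurableSpace X] {μ : Measure X} {t : ENNReal}

/-- The self-coupling of `μ` which is the diagonal coupling with weight `1 - t` and the independent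
coupling with weight `t`. -/
noncomputable def mixCoupling (μ : Measure X) (t : ENNReal) : Measure (X × X) :=
  (1 - t) • μ.map (fun x => (x, x)) + t • μ.prod μ

theorem mixCoupling_map_fst [IsProbabilityMeasure μ] (ht : t ≤ 1) :
    (mixCoupling μ t).map Prod.fst = μ := by
  rw [mixCoupling, Measure.map_add _ _ measurable_fst, Measure.map_smul, Measure.map_smul,
    Measure.map_map measurable_fst (by fun_prop), Measure.map_fst_prod, measure_univ, one_smul]
  change (1 - t) • μ.map id + t • μ = μ
  rw [Measure.map_id, ← add_smul, tsub_add_cancel_of_le ht, one_smul]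

theorem mixCoupling_map_snd [IsProbabilityMeasure μ] (ht : t ≤ 1) :
    (mixCoupling μ t).map Prod.snd = μ := by
  rw [mixCoupling, Measure.map_add _ _ measurable_snd, Measure.map_smul, Measure.map_smul,
    Measure.map_map measurable_snd (by fun_prop), Measure.map_snd_prod, measure_univ, one_smul]
  change (1 - t) • μ.map id + t • μ = μ
  rw [Measure.map_id, ← add_smul, tsub_add_cancel_of_le ht, one_smul]

theorem isProbabilityMeasure_mixCoupling [IsProbabilityMeasure μ] (ht : t ≤ 1) :
    IsProbabilityMeasure (mixCoupling μ t) := by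
  have : IsProbabilityMeasure ((mixCoupling μ t).map Prod.fst) := by
    rw [mixCoupling_map_fst ht]; infer_instance
  exact Measure.isProbabilityMeasure_of_map (f := Prod.fst)

theorem measurePreserving_mixCoupling [IsProbabilityMeasure μ] {f : X → X}
    (hf : MeasurePreserving f μ μ) :
    MeasurePreserving (Prod.map f f) (mixCoupling μ t) (mixCoupling μ t) := by
  have hm := hf.measurable
  refine ⟨by fun_prop, ?_⟩
  rw [mixCoupling, Measure.map_add _ _ (by fun_prop), Measure.map_smul, Measure.map_smul,
    (hf.prod hf).map_eq, Measure.map_map (by fun_prop) (by fun_prop)]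
  congr 2
  nth_rewrite 2 [← hf.map_eq]
  rw [Measure.map_map (by fun_prop) hm]
  rfl

theorem mixCoupling_prod_compl_le [IsProbabilityMeasure μ] {A B : Set X} (hA : MeasurableSet A)
    (hB : MeasurableSet B) (hAB : Disjoint A B) : mixCoupling μ t (A ×ˢ B) ≤ t := by
  have h0 : (fun x : X => (x, x)) ⁻¹' (A ×ˢ B) = ∅ := by
    ext x
    simpa using fun h h' => Set.disjoint_left.1 hAB h h'
  rw [mixCoupling, Measure.add_apply, Measure.smul_apply, Measure.smul_apply,
    Measure.map_apply (by fun_prop) (hA.prod hB), h0]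
  simpa using mul_le_of_le_one_right' (mul_le_one' (prob_le_one (μ := μ) (s := A)) prob_le_one)

/-- By Fubini, a diagonal of full measure would give `μ {x} = 1` for almost every `x`. -/
theorem prod_diagonal_ne_one [IsProbabilityMeasure μ] [MeasurableEq X]
    (hμ : ∀ x : X, μ {x} ≠ 1) : μ.prod μ (Set.diagonal X) ≠ 1 := by
  intro h
  have hc : μ.prod μ (Set.diagonal X)ᶜ = 0 := by
    rwa [prob_compl_eq_zero_iff measurableSet_diagonal]
  rw [Measure.measure_prod_null measurableSet_diagonal.compl] at hc
  obtain ⟨x, hx⟩ := hc.exists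
  have e : Prod.mk x ⁻¹' (Set.diagonal X)ᶜ = {x}ᶜ := by
    ext y
    simp [eq_comm]
  have hmeas : MeasurableSet ({x} : Set X) := by
    have := measurableSet_diagonal.preimage (measurable_prodMk_left (x := x) (β := X))
    convert this using 1
    ext y
    simp [eq_comm]
  simp only [e, Pi.zero_apply] at hx
  rw [prob_compl_eq_zero_iff hmeas] at hx
  exact hμ x hx

theorem mixCoupling_diagonal_lt_one [IsProbabilityMeasure μ] [MeasurableEq X]
    (hμ : ∀ x : X, μ {x} ≠ 1) (ht₀ : t ≠ 0) (ht : t ≤ 1) :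
    mixCoupling μ t (Set.diagonal X) < 1 := by
  have hlt : μ.prod μ (Set.diagonal X) < 1 := lt_of_le_of_ne prob_le_one (prod_diagonal_ne_one hμ)
  have ht' : t ≠ ⊤ := ne_top_of_le_ne_top ENNReal.one_ne_top ht
  have e : (fun x : X => (x, x)) ⁻¹' Set.diagonal X = Set.univ := by
    ext x
    simp
  rw [mixCoupling, Measure.add_apply, Measure.smul_apply, Measure.smul_apply,
    Measure.map_apply (by fun_prop) measurableSet_diagonal, e, measure_univ, smul_eq_mul, mul_one,
    smul_eq_mul]
  calc 1 - t + t * μ.prod μ (Set.diagonal X) < 1 - t + t * 1 :=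
        ENNReal.add_lt_add_left (by simp) (ENNReal.mul_lt_mul_right ht₀ ht' hlt)
    _ = 1 := by rw [mul_one, tsub_add_cancel_of_le ht]

end Coupling

/-! ### Independent products of couplings. -/

section InfiniteProduct

variable {X D : Type*} [MeasurableSpace X]

/-- Injectivity of `e` is enough: conditions on distinct `d` become conditions on distinct, hence
independent, coordinates `e d`. -/
theorem infinitePi_map_comp_injective (ρ : Measure X) [IsProbabilityMeasure ρ] {e : D → D}
    (he : e.Injective) {f : D → X → X} (hf : ∀ d, MeasurePreserving (f d) ρ ρ) :
    (Measure.infinitePi fun _ : D => ρ).map (fun p d => f d (p (e d))) =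
      Measure.infinitePi fun _ : D => ρ := by
  classical
  have hm := fun d => (hf d).measurable
  refine Measure.eq_infinitePi _ fun s t ht => ?_
  have hs : MeasurableSet ((s : Set D).pi t) := .pi s.countable_toSet fun d _ => ht d
  -- `invFun`, which recovers `d` from `e d`, needs `D` nonempty.
  rcases isEmpty_or_nonempty D with hD | hD
  · obtain rfl : s = ∅ := Subsingleton.elim _ _
    rw [Measure.map_apply (by fun_prop) hs]
    simp
  have e₁ : (fun (p : D → X) d => f d (p (e d))) ⁻¹' (s : Set D).pi t =
      ((s.map ⟨e, he⟩ : Finset D) : Set D).pi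
        fun c => f (e.invFun c) ⁻¹' t (e.invFun c) := by
    ext p
    simp [Set.mem_pi, Function.leftInverse_invFun he _]
  rw [Measure.map_apply (by fun_prop) hs, e₁,
    Measure.infinitePi_pi _ fun c _ => hm _ (ht _), Finset.prod_map]
  refine Finset.prod_congr rfl fun d _ => ?_
  simp only [Function.Embedding.coeFn_mk, Function.leftInverse_invFun he d]
  exact (hf d).measure_preimage (ht d).nullMeasurableSet

/-- The independent product over `D` of copies of `ρ`, as a measure on pairs of families. -/
noncomputable def piCoupling (D : Type*) (ρ : Measure (X × X)) [IsProbabilityMeasure ρ] :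
    Measure ((D → X) × (D → X)) :=
  (Measure.infinitePi fun _ : D => ρ).map fun p => (fun d => (p d).1, fun d => (p d).2)

variable (ρ : Measure (X × X)) [IsProbabilityMeasure ρ]

instance : IsProbabilityMeasure (piCoupling D ρ) :=
  Measure.isProbabilityMeasure_map (by fun_prop)

theorem piCoupling_map_fst {μ : Measure X} [IsProbabilityMeasure μ] (h : ρ.map Prod.fst = μ) :
    (piCoupling D ρ).map Prod.fst = Measure.infinitePi fun _ : D => μ := by
  subst h
  rw [piCoupling, Measure.map_map measurable_fst (by fun_prop)]
  exact Measure.infinitePi_map_pi (μ := fun _ : D => ρ) fun _ => measurable_fst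

theorem piCoupling_map_snd {μ : Measure X} [IsProbabilityMeasure μ] (h : ρ.map Prod.snd = μ) :
    (piCoupling D ρ).map Prod.snd = Measure.infinitePi fun _ : D => μ := by
  subst h
  rw [piCoupling, Measure.map_map measurable_snd (by fun_prop)]
  exact Measure.infinitePi_map_pi (μ := fun _ : D => ρ) fun _ => measurable_snd

theorem piCoupling_eval_prod {A B : Set X} (hA : MeasurableSet A) (hB : MeasurableSet B) (d : D) :
    piCoupling D ρ ((Function.eval d ⁻¹' A) ×ˢ (Function.eval d ⁻¹' B)) = ρ (A ×ˢ B) := by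
  rw [piCoupling, Measure.map_apply (by fun_prop)
    ((measurable_pi_apply d hA).prod (measurable_pi_apply d hB))]
  exact (measurePreserving_eval_infinitePi (fun _ : D => ρ) d).measure_preimage
    (hA.prod hB).nullMeasurableSet

/-- Agreement on `k` coordinates already has probability `ρ (diagonal) ^ k`, for every `k`. -/
theorem piCoupling_diagonal_eq_zero [Countable D] [Infinite D] [MeasurableEq X]
    (h : ρ (Set.diagonal X) < 1) :
    piCoupling D ρ (Set.diagonal (D → X)) = 0 := by
  have hle : ∀ k : ℕ, piCoupling D ρ (Set.diagonal (D → X)) ≤ ρ (Set.diagonal X) ^ k := by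
    intro k
    obtain ⟨s, hs⟩ := Infinite.exists_subset_card_eq D k
    have hd : MeasurableSet {q : (D → X) × (D → X) | ∀ d ∈ s, q.1 d = q.2 d} := by
      simp only [Set.ofPred_forall]
      exact .biInter s.countable_toSet fun d _ =>
        measurableSet_eq_fun (by fun_prop) (by fun_prop)
    refine (measure_mono (t := {q : (D → X) × (D → X) | ∀ d ∈ s, q.1 d = q.2 d})
      fun q hq d _ => congrFun hq d).trans ?_
    rw [piCoupling, Measure.map_apply (by fun_prop) hd]
    have := Measure.infinitePi_pi (fun _ : D => ρ) (s := s) (t := fun _ => Set.diagonal X)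
      fun _ _ => measurableSet_diagonal
    rw [Finset.prod_const, hs] at this
    exact this.le
  exact le_antisymm (ge_of_tendsto' (ENNReal.tendsto_pow_atTop_nhds_zero_of_lt_one h) hle) zero_le

theorem piCoupling_map_prodMap {e : D → D} (he : e.Injective) {f : D → X → X}
    (hm : ∀ d, Measurable (f d))
    (hf : ∀ d, MeasurePreserving (Prod.map (f d) (f d)) ρ ρ) :
    (piCoupling D ρ).map (Prod.map (fun x d => f d (x (e d))) (fun x d => f d (x (e d)))) =
      piCoupling D ρ := by
  rw [piCoupling, Measure.map_map (by fun_prop) (by fun_prop)]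
  nth_rewrite 2 [← infinitePi_map_comp_injective ρ he hf]
  rw [Measure.map_map (by fun_prop) (by fun_prop)]
  rfl

end InfiniteProduct

/-! ### The two directions for the co-induced action. -/

section Coinduction

variable {Γ : Type*} [Group Γ] {Γ₀ : Subgroup Γ} {D : Set Γ}

theorem domAct_injective (hD : Subgroup.IsComplement D (Γ₀ : Set Γ)) (γ : Γ) :
    (domAct hD γ).Injective := by
  intro d d' h
  have h₁ := domAct_mul_domCocycle hD γ d
  have h₂ := domAct_mul_domCocycle hD γ d'
  rw [← h, ← eq_mul_inv_iff_mul_eq] at h₂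
  rw [h₂] at h₁
  -- Equal images put `d` and `d'` in one coset, so both represent `1 . d`.
  have h₃ := (dom_unique hD (γ := 1) (d := d) (d' := d')
    (s := (domCocycle hD γ d')⁻¹ * domCocycle hD γ d) (by
      apply mul_left_cancel (a := γ)
      rw [one_mul, ← h₁]
      push_cast
      group)).1
  have h₄ := (dom_unique hD (γ := 1) (d := d) (d' := d) (s := 1) (by simp)).1
  exact h₄.symm.trans h₃

theorem coinducedAction_conj_apply (hD : Subgroup.IsComplement D (Γ₀ : Set Γ)) {X : Type*}
    [MulAction Γ₀ X] (d : D) (s : Γ₀) (x : D → X) :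
    (coinducedAction hD X).smul ((d : Γ) * s * (d : Γ)⁻¹) x d = s • x d := by
  obtain ⟨h₁, h₂⟩ := dom_unique hD (γ := ((d : Γ) * s * (d : Γ)⁻¹)⁻¹) (d := d) (d' := d)
    (s := s⁻¹) (by push_cast; group)
  change (domCocycle hD _ d)⁻¹ • x (domAct hD _ d) = _
  rw [h₁, h₂, inv_inv]

variable {X : Type*} [MeasurableSpace X] [MulAction Γ₀ X] [MeasurableConstSMul Γ₀ X]

theorem measurable_coinducedAction_smul (hD : Subgroup.IsComplement D (Γ₀ : Set Γ)) (γ : Γ) :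
    Measurable ((coinducedAction hD X).smul γ) :=
  measurable_pi_lambda _ fun d =>
    (measurable_const_smul (domCocycle hD γ⁻¹ d)⁻¹).comp (measurable_pi_apply (domAct hD γ⁻¹ d))

variable [StandardBorelSpace X] (μ : Measure X) [IsProbabilityMeasure μ]

theorem isRigidAction_coinduced_of_finite [SMulInvariantMeasure Γ₀ X μ]
    (hrigid : IsRigidAction Γ₀ μ) (hD : Subgroup.IsComplement D (Γ₀ : Set Γ)) [Finite D] :
    letI : MulAction Γ (D → X) := coinducedAction hD X
    IsRigidAction Γ (Measure.infinitePi fun _ : D => μ) := by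
  let : MulAction Γ (D → X) := coinducedAction hD X
  intro ν h₁ h₂ hweak hinv
  have hγ (γ : Γ) : Measurable fun x : D → X => γ • x := measurable_coinducedAction_smul hD γ
  have hcoord (d : D) : Tendsto (fun n => (ν n : Measure ((D → X) × (D → X))) {q | q.1 d = q.2 d}) atTop (𝓝 1) := by
    have hev := measurePreserving_eval_infinitePi (fun _ : D => μ) d
    have hpr : Measurable fun q : (D → X) × (D → X) => (q.1 d, q.2 d) := by fun_prop
    have key := hrigid (fun n => (ν n).map hpr.aemeasurable) ?_ ?_ ?_ ?_
    · refine key.congr fun n => ?_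
      rw [ProbabilityMeasure.toMeasure_map, Measure.map_apply hpr measurableSet_diagonal]
      rfl
    · intro n
      rw [ProbabilityMeasure.toMeasure_map, Measure.map_map measurable_fst hpr, ← hev.map_eq,
        ← h₁ n, Measure.map_map hev.measurable measurable_fst]
      rfl
    · intro n
      rw [ProbabilityMeasure.toMeasure_map, Measure.map_map measurable_snd hpr, ← hev.map_eq,
        ← h₂ n, Measure.map_map hev.measurable measurable_snd]
      rfl
    · rintro φ ψ hφ hψ ⟨C, hC⟩ ⟨K, hK⟩
      have := hweak (fun x => φ (x d)) (fun x => ψ (x d)) (by fun_prop) (by fun_prop)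
        ⟨C, fun _ => hC _⟩ ⟨K, fun _ => hK _⟩
      have e : ∫ x, φ x * ψ x ∂μ =
          ∫ x, φ (x d) * ψ (x d) ∂(Measure.infinitePi fun _ : D => μ) := by
        conv_lhs => rw [← hev.map_eq]
        rw [integral_map hev.measurable.aemeasurable (by fun_prop)]
      rw [e]
      refine this.congr fun n => ?_
      rw [ProbabilityMeasure.toMeasure_map, integral_map hpr.aemeasurable (by fun_prop)]
    · intro s
      have hc := hinv ((d : Γ) * s * (d : Γ)⁻¹)
      refine tendsto_of_tendsto_of_tendsto_of_le_of_le tendsto_const_nhds hc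
        (fun _ => zero_le) fun n => ?_
      have hg : Measurable fun q : (D → X) × (D → X) =>
          (((d : Γ) * s * (d : Γ)⁻¹) • q.1, ((d : Γ) * s * (d : Γ)⁻¹) • q.2) :=
        ((hγ _).comp measurable_fst).prodMk ((hγ _).comp measurable_snd)
      have hs : Measurable fun q : X × X => (s • q.1, s • q.2) := by fun_prop
      refine le_trans (le_of_eq (tvDist_congr ?_ (ProbabilityMeasure.toMeasure_map _ _)))
        (tvDist_map_le _ _ hpr)
      rw [ProbabilityMeasure.toMeasure_map, Measure.map_map hs hpr, Measure.map_map hpr hg]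
      congr 1
      funext q
      exact (Prod.ext (coinducedAction_conj_apply hD d s q.1)
        (coinducedAction_conj_apply hD d s q.2)).symm
  have hmeas (d : D) : MeasurableSet {q : (D → X) × (D → X) | q.1 d = q.2 d} :=
    measurableSet_eq_fun (by fun_prop) (by fun_prop)
  have hcompl (d : D) :
      Tendsto (fun n => (ν n : Measure ((D → X) × (D → X))) {q | q.1 d = q.2 d}ᶜ) atTop (𝓝 0) := by
    have := ENNReal.Tendsto.sub (tendsto_const_nhds (x := (1 : ENNReal))) (hcoord d)
      (.inl ENNReal.one_ne_top)
    rw [tsub_self] at this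
    exact this.congr fun n => (prob_compl_eq_one_sub (hmeas d)).symm
  have := Fintype.ofFinite D
  have hdiag : MeasurableSet (Set.diagonal (D → X)) := measurableSet_diagonal
  have hzero : Tendsto (fun n => (ν n : Measure ((D → X) × (D → X))) (Set.diagonal (D → X))ᶜ) atTop (𝓝 0) := by
    have hsum := tendsto_finsetSum (Finset.univ : Finset D) fun d _ => hcompl d
    rw [Finset.sum_const_zero] at hsum
    refine tendsto_of_tendsto_of_tendsto_of_le_of_le tendsto_const_nhds hsum
      (fun _ => zero_le) fun n => ?_
    refine (measure_mono ?_).trans (measure_biUnion_finset_le Finset.univ _)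
    intro q hq
    obtain ⟨d, hd⟩ := Function.ne_iff.1 (show q.1 ≠ q.2 from hq)
    exact Set.mem_biUnion (Finset.mem_univ d) hd
  have hone := ENNReal.Tendsto.sub (tendsto_const_nhds (x := (1 : ENNReal))) hzero
    (.inl ENNReal.one_ne_top)
  rw [tsub_zero] at hone
  refine hone.congr fun n => ?_
  rw [← prob_compl_eq_one_sub hdiag.compl, compl_compl]

theorem not_isRigidAction_coinduced_of_infinite [SMulInvariantMeasure Γ₀ X μ]
    (hμ : ∀ x : X, μ {x} ≠ 1) (hD : Subgroup.IsComplement D (Γ₀ : Set Γ))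
    [Countable D] [Infinite D] :
    letI : MulAction Γ (D → X) := coinducedAction hD X
    ¬ IsRigidAction Γ (Measure.infinitePi fun _ : D => μ) := by
  let : MulAction Γ (D → X) := coinducedAction hD X
  intro h
  -- The weights must tend to 0 for concentration but stay positive to keep every diagonal null.
  let t : ℕ → ENNReal := fun n => ((n : ENNReal) + 1)⁻¹
  have ht (n) : t n ≤ 1 := ENNReal.inv_le_one.2 le_add_self
  have ht₀ (n) : t n ≠ 0 := ENNReal.inv_ne_zero.2 (by simp)
  have htlim : Tendsto t atTop (𝓝 0) := by
    have := ENNReal.tendsto_inv_nat_nhds_zero.comp (tendsto_add_atTop_nat 1)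
    exact this.congr fun n => by simp [t]
  have hρ (n) : IsProbabilityMeasure (mixCoupling μ (t n)) :=
    isProbabilityMeasure_mixCoupling (ht n)
  let ν : ℕ → ProbabilityMeasure ((D → X) × (D → X)) := fun n =>
    ⟨piCoupling D (mixCoupling μ (t n)), inferInstance⟩
  have h₁ (n) : (ν n : Measure ((D → X) × (D → X))).map Prod.fst = Measure.infinitePi fun _ : D => μ :=
    piCoupling_map_fst _ (mixCoupling_map_fst (ht n))
  have h₂ (n) : (ν n : Measure ((D → X) × (D → X))).map Prod.snd = Measure.infinitePi fun _ : D => μ :=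
    piCoupling_map_snd _ (mixCoupling_map_snd (ht n))
  have hbase (d : D) {A B : Set X} (hA : MeasurableSet A) (hB : MeasurableSet B)
      (hAB : Disjoint A B) : Tendsto (fun n => (ν n : Measure ((D → X) × (D → X)))
        ((Function.eval d ⁻¹' A) ×ˢ (Function.eval d ⁻¹' B))) atTop (𝓝 0) :=
    tendsto_of_tendsto_of_tendsto_of_le_of_le tendsto_const_nhds htlim (fun _ => zero_le)
      fun n => (piCoupling_eval_prod _ hA hB d).trans_le (mixCoupling_prod_compl_le hA hB hAB)
  have hgen : (MeasurableSpace.pi : MeasurableSpace (D → X)) = MeasurableSpace.generateFrom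
      {S | ∃ (d : D) (A : Set X), MeasurableSet A ∧ Function.eval d ⁻¹' A = S} := by
    rw [MeasurableSpace.pi_eq_generateFrom_projections]
  have hconc : ∀ A : Set (D → X), MeasurableSet A →
      Tendsto (fun n => (ν n : Measure ((D → X) × (D → X))) (A ×ˢ Aᶜ)) atTop (𝓝 0) := fun A hA =>
    tendsto_prod_compl_of_generateFrom hgen h₁ h₂ (by
      rintro _ ⟨d, A, hA, rfl⟩
      exact ⟨hbase d hA hA.compl disjoint_compl_right,
        hbase d hA.compl hA disjoint_compl_left⟩) hA
  have hlim := h ν h₁ h₂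
    (fun φ ψ hφ hψ bφ bψ => tendsto_integral_mul_of_tendsto_prod_compl h₁ h₂ hconc hφ hψ bφ bψ)
    (fun γ => by
      have hinv (n) : (ν n : Measure ((D → X) × (D → X))).map (fun p => (γ • p.1, γ • p.2)) = ν n :=
        piCoupling_map_prodMap _ (domAct_injective hD γ⁻¹)
          (f := fun d x => (domCocycle hD γ⁻¹ d)⁻¹ • x) (fun d => measurable_const_smul _)
          fun d => measurePreserving_mixCoupling (measurePreserving_smul _ μ)
      refine tendsto_const_nhds.congr fun n => ?_
      simp only [hinv]
      exact (tvDist_self _).symm)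
  have hzero (n) : (ν n : Measure ((D → X) × (D → X))) (Set.diagonal (D → X)) = 0 :=
    piCoupling_diagonal_eq_zero _ (mixCoupling_diagonal_lt_one hμ (ht₀ n) (ht n))
  simp only [hzero] at hlim
  exact zero_ne_one (tendsto_nhds_unique tendsto_const_nhds hlim)

end Coinduction

theorem proposition1p6 {Γ : Type*} [Group Γ] [Countable Γ] (Γ₀ : Subgroup Γ)
    {X : Type*} [MeasurableSpace X] [StandardBorelSpace X] [MulAction Γ₀ X]
    [MeasurableConstSMul Γ₀ X]
    (μ : Measure X) [IsProbabilityMeasure μ] [SMulInvariantMeasure Γ₀ X μ]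
    (hμ : ∀ x : X, μ {x} ≠ 1)
    (hrigid : IsRigidAction Γ₀ μ)
    (D : Set Γ) (hD : Subgroup.IsComplement D (Γ₀ : Set Γ)) :
    letI : MulAction Γ (D → X) := coinducedAction hD X
    IsRigidAction Γ (Measure.infinitePi fun _ : D => μ) ↔ Γ₀.FiniteIndex := by
  -- `D` is in bijection with the left cosets, so finite index means that `D` is finite.
  rw [← hD.finite_left_iff]
  constructor
  · intro h
    by_contra hfin
    have : Infinite D := not_finite_iff_infinite.1 hfin
    exact not_isRigidAction_coinduced_of_infinite μ hμ hD h
  · intro hfin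
    exact isRigidAction_coinduced_of_finite μ hrigid hD
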